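/- Theorem 1. Fix $p\in(1/2,1)$ and a ground truth $b\in\{0,1\}$. Nodes $1,\dots,n$ decide one after the other. Node $i$ receives a private signal $s_i$ which equals $b$ with probability $p$ and $1-b$ with probability $1-p$; the signals are independent of each other and of the graph. The random graph $G(n,q)$ has vertex set $\{1,\dots,n\}$, and each pair of nodes is joined by an edge independently with probability $q$. Every node uses the Majority Algorithm: the decision $c_i\in\{0,1\}$ of node $i$ is the majority of its own private signal $s_i$ and of the decisions $c_j$ of its neighbours $j<i$, and it is $s_i$ if there is a tie. Let $\mathcal{E}_{G(n,q)}$ be the expected number (over the random graph and the signals) of nodes $i$ with $c_i\neq b$. Then there are connection probabilities $q=q(n)\in[0,1]$, which depend on $n$ and $p$ only, such that, as $n\to\infty$, $q(n)=\Theta(1/\log n)$ and, for either value of $b$, $\mathcal{E}_{G(n,q(n))}=\Theta(\log n)$. The implied constants may depend on $p$. In particular, the expected fraction of wrong nodes, $\mathcal{E}_{G(n,q(n))}/n$, tends to $0$. -/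

import Mathlib

open MeasureTheory Filter Topology Asymptotics

noncomputable section

namespace InfoCascade

/-- A family of decision-making algorithms `L_1, …, L_n`: node `i` maps the vector of the decisions
of all earlier nodes, together with its own private signal, to its own decision. -/
abbrev Algorithms (n : ℕ) : Type :=
  (i : Fin n) → (Fin i → Bool) → Bool → Bool

/-- The decisions `c_i = L_i((c_1, …, c_{i-1}), s_i)`, taken one node after the other. -/
def decision {n : ℕ} (L : Algorithms n) (s : Fin n → Bool) (i : Fin n) : Bool :=
  L i (fun j : Fin i => decision L s ⟨j, j.2.trans i.2⟩) (s i)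
termination_by i.val
decreasing_by exact j.2

/-- The majority of the bits in `m` together with the bit `s`; if there is a tie, the output
is `s`. -/
def maj (m : Multiset Bool) (s : Bool) : Bool :=
  if (s ::ₘ m).count s < (s ::ₘ m).count (!s) then !s else s

open Classical in
/-- The Majority Algorithm on the graph `G`: each node outputs the majority of the decisions of its
earlier neighbours and its own private signal, and its own private signal if there is a tie. -/
def majority {n : ℕ} (G : SimpleGraph (Fin n)) : Algorithms n := fun i c s =>
  maj ((Finset.univ.filter fun j : Fin i => G.Adj ⟨j, j.2.trans i.2⟩ i).val.map c) s

/-- The law of the private signals: independent, each equal to the ground truth `b` with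
probability `p` and to `!b` with probability `1 - p`. -/
def signalLaw (n : ℕ) (p : unitInterval) (b : Bool) : Measure (Fin n → Bool) :=
  Measure.pi fun _ => ProbabilityTheory.bernoulliMeasure b (!b) p

/-- The number of nodes whose decision is wrong. -/
def numWrong {n : ℕ} (L : Algorithms n) (b : Bool) (s : Fin n → Bool) : ℕ :=
  (Finset.univ.filter fun i => decision L s i ≠ b).card

/-- The expected number of wrong nodes for given algorithms, over the private signals. -/
def expectedWrong {n : ℕ} (p : unitInterval) (b : Bool) (L : Algorithms n) : ℝ :=
  ∫ s, (numWrong L b s : ℝ) ∂(signalLaw n p b)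

/-- The expected number of wrong nodes in the random graph `G(n, q)`, over the graph and the
private signals (which are independent of the graph), when all nodes apply the Majority
Algorithm. -/
def expectedWrongRandomGraph (n : ℕ) (q p : unitInterval) (b : Bool) : ℝ :=
  ∫ G, expectedWrong p b (majority G) ∂(SimpleGraph.binomialRandom (Fin n) q)

/-- On finitely many vertices, every set of graphs is measurable; so every function of the graph is
integrable with respect to the law of the random graph. -/
instance (n : ℕ) : MeasurableSingletonClass (SimpleGraph (Fin n)) where
  measurableSet_singleton G := by
    refine ⟨{G.Adj}, measurableSet_singleton _, ?_⟩
    ext H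
    exact ⟨fun h => SimpleGraph.ext h, fun h => congrArg SimpleGraph.Adj h⟩

end InfoCascade

end

/-! The edges from node `k` to earlier nodes and its signal are independent of all earlier
decisions. So, given `w` wrong and `r` right earlier nodes, node `k` errs with a probability
`wrongProb q p w r` defined by two independent binomials, and the set of wrong nodes is a growth
process driven by `wrongProb` (`isGrowthLaw_wrongLaw`).

Three upper bounds drive the process. While `q * (w + r)` is small, the error probability is close
to `1 - p` whatever the past (`wrongProb_le_add`). If `w ≤ ρ * r` with `p * ρ ^ 2 = 1 - p`, it is at
most `1 - p` at any time (`wrongProb_le_one_sub`), and it also decays exponentially in `q * (w + r)`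
(`wrongProb_le_exp`). Since `p > 1/2`, the fraction `α = ρ / (1 + ρ)` exceeds `1 - p`, so sparsity
of wrong nodes sustains itself: an exponential supermartingale bounds the probability of exceeding
`α` after about `1 / q` nodes by a constant times `exp (-c / q)` (`sum_dense_le`).

The expected number of errors is thus at most `A / q` (initial nodes and the geometric tail) plus `B
* n * exp (-c / q)` (failed cascades). The choice `q = c / log n` makes both terms `O(log n)`.
Conversely, about `1 / q` initial nodes have a fair chance of no earlier neighbour, which forces
order `1 / q` errors. -/

noncomputable section

namespace InfoCascade

/-! ### Error probability of one node, given the counts of wrong and right predecessors -/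

/-- The probability that a binomial random variable with parameters `n` and `q` equals `a`. -/
def binWeight (q : ℝ) (n a : ℕ) : ℝ := n.choose a * q ^ a * (1 - q) ^ (n - a)

/-- The expectation of `g A C` for independent binomial random variables `A` and `C` with `w` and
`r` trials and success probability `q`. -/
def binExp (q : ℝ) (w r : ℕ) (g : ℕ → ℕ → ℝ) : ℝ :=
  ∑ a ∈ Finset.range (w + 1), ∑ c ∈ Finset.range (r + 1), binWeight q w a * binWeight q r c * g a c

/-- The probability that a node with `a` wrong and `c` right neighbours is wrong, where its signal
is right with probability `p`. -/
def wrongGiven (p : ℝ) (a c : ℕ) : ℝ :=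
  (1 - p) * (if c ≤ a + 1 then 1 else 0) + p * (if c + 2 ≤ a then 1 else 0)

/-- The probability that a node is wrong when `w` of the earlier nodes are wrong and `r` are
right. -/
def wrongProb (q p : ℝ) (w r : ℕ) : ℝ := binExp q w r (wrongGiven p)

variable {q p : ℝ} {w r : ℕ}

lemma binWeight_nonneg (hq : 0 ≤ q) (hq1 : q ≤ 1) (n a : ℕ) : 0 ≤ binWeight q n a := by
  have := sub_nonneg.2 hq1
  unfold binWeight
  positivity

lemma sum_binWeight_mul_pow (q x : ℝ) (n : ℕ) :
    ∑ a ∈ Finset.range (n + 1), binWeight q n a * x ^ a = (q * x + (1 - q)) ^ n := by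
  rw [add_pow]
  refine Finset.sum_congr rfl fun a _ => ?_
  rw [binWeight, mul_pow]
  ring

lemma sum_binWeight (q : ℝ) (n : ℕ) : ∑ a ∈ Finset.range (n + 1), binWeight q n a = 1 := by
  simpa using sum_binWeight_mul_pow q 1 n

lemma binExp_mul (q : ℝ) (w r : ℕ) (g h : ℕ → ℝ) :
    binExp q w r (fun a c => g a * h c) =
      (∑ a ∈ Finset.range (w + 1), binWeight q w a * g a) *
        ∑ c ∈ Finset.range (r + 1), binWeight q r c * h c := by
  rw [binExp, Finset.sum_mul_sum]
  exact Finset.sum_congr rfl fun a _ => Finset.sum_congr rfl fun c _ => by ring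

lemma binExp_const (q : ℝ) (w r : ℕ) (x : ℝ) : binExp q w r (fun _ _ => x) = x := by
  have := binExp_mul q w r (fun _ => x) (fun _ => 1)
  simp only [mul_one, ← Finset.sum_mul, sum_binWeight, one_mul] at this
  exact this

lemma binExp_mono (hq : 0 ≤ q) (hq1 : q ≤ 1) {g h : ℕ → ℕ → ℝ} (H : ∀ a c, g a c ≤ h a c) :
    binExp q w r g ≤ binExp q w r h :=
  Finset.sum_le_sum fun a _ => Finset.sum_le_sum fun c _ => mul_le_mul_of_nonneg_left (H a c)
    (mul_nonneg (binWeight_nonneg hq hq1 _ _) (binWeight_nonneg hq hq1 _ _))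

lemma binExp_add (q : ℝ) (w r : ℕ) (g h : ℕ → ℕ → ℝ) :
    binExp q w r (fun a c => g a c + h a c) = binExp q w r g + binExp q w r h := by
  simp only [binExp, mul_add, Finset.sum_add_distrib]

lemma binExp_const_mul (q : ℝ) (w r : ℕ) (x : ℝ) (g : ℕ → ℕ → ℝ) :
    binExp q w r (fun a c => x * g a c) = x * binExp q w r g := by
  simp only [binExp, Finset.mul_sum]
  exact Finset.sum_congr rfl fun a _ => Finset.sum_congr rfl fun c _ => by ring

/-- Since `0 ^ 0 = 1`, the integrand is the indicator of having no earlier neighbour. -/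
lemma binExp_zero_zero (q : ℝ) (w r : ℕ) :
    binExp q w r (fun a c => 0 ^ a * 0 ^ c) = (1 - q) ^ (w + r) := by
  rw [binExp_mul, sum_binWeight_mul_pow, sum_binWeight_mul_pow, pow_add]
  simp

lemma wrongGiven_nonneg (hp : 0 ≤ p) (hp1 : p ≤ 1) (a c : ℕ) : 0 ≤ wrongGiven p a c := by
  have := sub_nonneg.2 hp1
  unfold wrongGiven
  positivity

lemma wrongGiven_le_one (hp : 0 ≤ p) (hp1 : p ≤ 1) (a c : ℕ) : wrongGiven p a c ≤ 1 := by
  unfold wrongGiven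
  split_ifs <;> linarith

lemma wrongProb_le_one (hq : 0 ≤ q) (hq1 : q ≤ 1) (hp : 0 ≤ p) (hp1 : p ≤ 1) (w r : ℕ) :
    wrongProb q p w r ≤ 1 := by
  have := binExp_mono (w := w) (r := r) hq hq1 (wrongGiven_le_one hp hp1)
  rwa [binExp_const] at this

/-- A node is wrong at least when it has no earlier neighbour and its signal is wrong. -/
lemma le_wrongProb (hq : 0 ≤ q) (hq1 : q ≤ 1) (hp : 0 ≤ p) (hp1 : p ≤ 1) (w r : ℕ) :
    (1 - p) * (1 - q) ^ (w + r) ≤ wrongProb q p w r := by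
  rw [← binExp_zero_zero, ← binExp_const_mul]
  refine binExp_mono hq hq1 fun a c => ?_
  rcases a with _ | a
  · rcases c with _ | c
    · simp [wrongGiven]
    · simpa using wrongGiven_nonneg hp hp1 _ _
  · simpa using wrongGiven_nonneg hp hp1 _ _

/-- A node with few earlier neighbours mostly follows its own signal. -/
lemma wrongProb_le_add (hq : 0 ≤ q) (hq1 : q ≤ 1) (hp : 0 ≤ p) (hp1 : p ≤ 1) (w r : ℕ) :
    wrongProb q p w r ≤ 1 - p + q * (w + r : ℕ) := by
  have h1 : wrongProb q p w r ≤ (1 - p) + (1 + (-1) * (1 - q) ^ (w + r)) := by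
    have e : (1 - p) + (1 + (-1) * (1 - q) ^ (w + r)) =
        binExp q w r fun a c => (1 - p) + (1 + (-1) * (0 ^ a * 0 ^ c)) := by
      rw [binExp_add, binExp_add, binExp_const_mul, binExp_zero_zero, binExp_const, binExp_const]
    rw [e]
    refine binExp_mono hq hq1 fun a c => ?_
    have : wrongGiven p a c ≤ 1 := wrongGiven_le_one hp hp1 _ _
    rcases a with _ | a
    · rcases c with _ | c
      · simp [wrongGiven]
      · simp; linarith
    · simp; linarith
  have h2 := one_add_mul_le_pow (a := -q) (by linarith) (w + r)
  rw [← sub_eq_add_neg] at h2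
  nlinarith

/-- Each increment of `k` multiplies the two sides by factors proportional to `w - (a + k)` and `ρ *
(r - (a + k))`. The first is at most the second, because `w ≤ ρ * r` and `ρ ≤ 1`. -/
lemma choose_mul_choose_le {ρ : ℝ} (hρ : 0 ≤ ρ) (hρ1 : ρ ≤ 1) (hw : (w : ℝ) ≤ ρ * r) (a k : ℕ) :
    (w.choose (a + k) * r.choose a : ℝ) ≤ ρ ^ k * (w.choose a * r.choose (a + k)) := by
  induction k with
  | zero => simp
  | succ k ih =>
    by_cases hk : w ≤ a + k
    · rw [Nat.choose_eq_zero_of_lt (show w < a + (k + 1) by omega)]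
      simp only [Nat.cast_zero, zero_mul]
      positivity
    have hwr : w ≤ r := by
      have : (w : ℝ) ≤ r := hw.trans (mul_le_of_le_one_left (by positivity) hρ1)
      exact_mod_cast this
    have e1 : (w.choose (a + (k + 1)) : ℝ) * (a + k + 1) = w.choose (a + k) * (w - (a + k)) := by
      have := Nat.choose_succ_right_eq w (a + k)
      rw [← add_assoc]
      have h2 : ((w - (a + k) : ℕ) : ℝ) = w - (a + k) := by
        rw [Nat.cast_sub (by omega)]; push_cast; ring
      rw [← h2]
      exact_mod_cast this
    have e2 : (r.choose (a + (k + 1)) : ℝ) * (a + k + 1) = r.choose (a + k) * (r - (a + k)) := by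
      have := Nat.choose_succ_right_eq r (a + k)
      rw [← add_assoc]
      have h2 : ((r - (a + k) : ℕ) : ℝ) = r - (a + k) := by
        rw [Nat.cast_sub (by omega)]; push_cast; ring
      rw [← h2]
      exact_mod_cast this
    have hpos : (0 : ℝ) < a + k + 1 := by positivity
    have hwk : (0 : ℝ) ≤ w - (a + k) := by
      have : ((a + k : ℕ) : ℝ) ≤ w := by exact_mod_cast (by omega : a + k ≤ w)
      push_cast at this
      linarith
    have hle : (w : ℝ) - (a + k) ≤ ρ * (r - (a + k)) := by
      nlinarith [mul_nonneg (sub_nonneg.2 hρ1) (show (0 : ℝ) ≤ a + k by positivity)]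
    refine le_of_mul_le_mul_right ?_ hpos
    calc (w.choose (a + (k + 1)) * r.choose a : ℝ) * (a + k + 1)
        = (w.choose (a + k) * r.choose a) * (w - (a + k)) := by linear_combination r.choose a * e1
      _ ≤ (ρ ^ k * (w.choose a * r.choose (a + k))) * (ρ * (r - (a + k))) :=
          mul_le_mul ih hle hwk (by positivity)
      _ = ρ ^ (k + 1) * (w.choose a * r.choose (a + (k + 1))) * (a + k + 1) := by
          linear_combination -ρ ^ (k + 1) * w.choose a * e2

/-- Exchanging the two counts preserves the total powers of `q` and `1 - q`, so only binomial
coefficients are compared. The gap of at least two, needed to overrule a signal, yields the factor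
`ρ ^ 2`. -/
lemma binWeight_mul_binWeight_le {ρ : ℝ} (hq : 0 ≤ q) (hq1 : q ≤ 1) (hρ : 0 ≤ ρ) (hρ1 : ρ ≤ 1)
    (hw : (w : ℝ) ≤ ρ * r) {a c : ℕ} (hac : a + 2 ≤ c) :
    binWeight q w c * binWeight q r a ≤ ρ ^ 2 * (binWeight q w a * binWeight q r c) := by
  have hwr : w ≤ r := by
    have : (w : ℝ) ≤ r := hw.trans (mul_le_of_le_one_left (by positivity) hρ1)
    exact_mod_cast this
  have hq' := sub_nonneg.2 hq1
  by_cases hc : c ≤ w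
  · obtain ⟨k, rfl⟩ : ∃ k, c = a + k := ⟨c - a, by omega⟩
    have h := choose_mul_choose_le hρ hρ1 hw a k
    have hk : ρ ^ k ≤ ρ ^ 2 := pow_le_pow_of_le_one hρ hρ1 (by omega)
    have h' : (w.choose (a + k) * r.choose a : ℝ) ≤ ρ ^ 2 * (w.choose a * r.choose (a + k)) :=
      h.trans (mul_le_mul_of_nonneg_right hk (by positivity))
    have e : (1 - q) ^ (w - (a + k)) * (1 - q) ^ (r - a) =
        (1 - q) ^ (w - a) * (1 - q) ^ (r - (a + k)) := by
      rw [← pow_add, ← pow_add]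
      congr 1
      omega
    calc binWeight q w (a + k) * binWeight q r a
        = (w.choose (a + k) * r.choose a) *
          (q ^ (a + k) * q ^ a * ((1 - q) ^ (w - (a + k)) * (1 - q) ^ (r - a))) := by
          simp only [binWeight]; ring
      _ ≤ (ρ ^ 2 * (w.choose a * r.choose (a + k))) *
          (q ^ (a + k) * q ^ a * ((1 - q) ^ (w - (a + k)) * (1 - q) ^ (r - a))) :=
          mul_le_mul_of_nonneg_right h' (by positivity)
      _ = _ := by rw [e]; simp only [binWeight]; ring
  · have : binWeight q w c = 0 := by
      simp [binWeight, Nat.choose_eq_zero_of_lt (not_le.1 hc)]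
    rw [this, zero_mul]
    have := binWeight_nonneg hq hq1
    have h1 := this w a
    have h2 := this r c
    positivity

/-- Weights beyond the number of trials vanish; a common range for both indices permits exchanging
their roles. -/
lemma binExp_eq_sum_range {N : ℕ} (hw : w < N) (hr : r < N) (g : ℕ → ℕ → ℝ) :
    binExp q w r g = ∑ a ∈ Finset.range N, ∑ c ∈ Finset.range N,
      binWeight q w a * binWeight q r c * g a c := by
  have h0 : ∀ n a, a ∉ Finset.range (n + 1) → binWeight q n a = 0 := fun n a h => by
    have : n < a := by simpa using h
    simp [binWeight, Nat.choose_eq_zero_of_lt this]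
  rw [binExp]
  refine (Finset.sum_congr rfl fun a _ => ?_).trans
    (Finset.sum_subset (Finset.range_subset_range.2 hw) fun a _ h => ?_)
  · refine Finset.sum_subset (Finset.range_subset_range.2 hr) fun c _ h => ?_
    rw [h0 _ _ h]; ring
  · rw [h0 _ _ h]; simp

/-- If the wrong nodes are sufficiently outnumbered, listening to the neighbours is at least as good
as following one's own signal. -/
lemma wrongProb_le_one_sub {ρ : ℝ} (hq : 0 ≤ q) (hq1 : q ≤ 1) (hp : 0 ≤ p) (hρ : 0 ≤ ρ)
    (hρ1 : ρ ≤ 1) (hpρ : p * ρ ^ 2 ≤ 1 - p) (hw : (w : ℝ) ≤ ρ * r) :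
    wrongProb q p w r ≤ 1 - p := by
  -- `up` and `lo` indicate that neighbours outvote a right, respectively a wrong, signal. Relative
  -- to following the signal, the error probability changes by `p * P(up) - (1 - p) * P(lo)`, and
  -- reflecting `(a, c)` to `(c, a)` gives `P(up) ≤ ρ ^ 2 * P(lo)`.
  set up : ℕ → ℕ → ℝ := fun a c => if c + 2 ≤ a then 1 else 0 with hup
  set lo : ℕ → ℕ → ℝ := fun a c => if a + 2 ≤ c then 1 else 0 with hlo
  have key : binExp q w r up ≤ ρ ^ 2 * binExp q w r lo := by
    have hw' : w < w + r + 1 := by omega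
    have hr' : r < w + r + 1 := by omega
    rw [binExp_eq_sum_range hw' hr', binExp_eq_sum_range hw' hr', Finset.sum_comm, Finset.mul_sum]
    refine Finset.sum_le_sum fun a _ => ?_
    rw [Finset.mul_sum]
    refine Finset.sum_le_sum fun c _ => ?_
    simp only [hup, hlo]
    split_ifs with h
    · simpa using binWeight_mul_binWeight_le hq hq1 hρ hρ1 hw h
    · simp
  have e : wrongProb q p w r = (1 - p) + ((-(1 - p)) * binExp q w r lo + p * binExp q w r up) := by
    have e' : (1 - p) + ((-(1 - p)) * binExp q w r lo + p * binExp q w r up) =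
        binExp q w r fun a c => (1 - p) + ((-(1 - p)) * lo a c + p * up a c) := by
      rw [binExp_add, binExp_add, binExp_const_mul, binExp_const_mul, binExp_const]
    rw [e']
    unfold wrongProb
    congr 1
    funext a c
    simp only [wrongGiven, hup, hlo]
    split_ifs <;> first | omega | ring
  have hlo0 : 0 ≤ binExp q w r lo := by
    have : binExp q w r (fun _ _ => 0) ≤ binExp q w r lo :=
      binExp_mono hq hq1 fun a c => by simp only [hlo]; positivity
    rwa [binExp_const] at this
  rw [e]
  nlinarith [mul_le_mul_of_nonneg_left key hp, mul_le_mul_of_nonneg_right hpρ hlo0]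

/-- If the wrong nodes are outnumbered, a node is wrong with probability exponentially small in its
expected number of neighbours. -/
lemma wrongProb_le_exp {x : ℝ} (hq : 0 ≤ q) (hq1 : q ≤ 1) (hp : 0 ≤ p) (hp1 : p ≤ 1) (hx : 0 < x)
    (hx1 : x ≤ 1) (hw : (w : ℝ) ≤ x ^ 2 * r) :
    wrongProb q p w r ≤ x⁻¹ * Real.exp (-((1 - x) ^ 2 / 2 * q * (w + r : ℕ))) := by
  -- Chernoff bound: an error requires `c ≤ a + 1`, hence `1 ≤ x⁻¹ * (x⁻¹ ^ a * x ^ c)`. The tilt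
  -- `x` is optimal when `w = x ^ 2 * r`.
  have h1 : wrongProb q p w r ≤ x⁻¹ * ((q * x⁻¹ + (1 - q)) ^ w * (q * x + (1 - q)) ^ r) := by
    rw [← sum_binWeight_mul_pow, ← sum_binWeight_mul_pow, ← binExp_mul, ← binExp_const_mul]
    refine binExp_mono hq hq1 fun a c => ?_
    by_cases h : c ≤ a + 1
    · refine (wrongGiven_le_one hp hp1 a c).trans ?_
      rw [← mul_assoc, ← pow_succ', inv_pow, ← div_eq_inv_mul, le_div_iff₀ (by positivity), one_mul]
      exact pow_le_pow_of_le_one hx.le hx1 h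
    · have : wrongGiven p a c = 0 := by
        simp [wrongGiven, h, show ¬ c + 2 ≤ a by omega]
      rw [this]
      positivity
  refine h1.trans (mul_le_mul_of_nonneg_left ?_ (by positivity))
  have hq' := sub_nonneg.2 hq1
  have b1 : (q * x⁻¹ + (1 - q)) ^ w ≤ Real.exp (w * (q * (x⁻¹ - 1))) := by
    rw [Real.exp_nat_mul]
    refine pow_le_pow_left₀ (by positivity) ?_ _
    linarith [Real.add_one_le_exp (q * (x⁻¹ - 1))]
  have b2 : (q * x + (1 - q)) ^ r ≤ Real.exp (r * (q * (x - 1))) := by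
    rw [Real.exp_nat_mul]
    refine pow_le_pow_left₀ (by positivity) ?_ _
    linarith [Real.add_one_le_exp (q * (x - 1))]
  refine (mul_le_mul b1 b2 (by positivity) (Real.exp_nonneg _)).trans ?_
  rw [← Real.exp_add, Real.exp_le_exp]
  have hinv : 0 ≤ x⁻¹ - 1 := sub_nonneg.2 ((one_le_inv₀ hx).2 hx1)
  have hxx : x * x⁻¹ = 1 := mul_inv_cancel₀ hx.ne'
  have hwr : (w : ℝ) ≤ r := hw.trans
    (mul_le_of_le_one_left (by positivity) (pow_le_one₀ hx.le hx1))
  -- The exponents add up to at most `-(1 - x) ^ 2 * q * r`; the factor `1 / 2` in the claim comes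
  -- from `w + r ≤ 2 * r`.
  have c1 : (w : ℝ) * (q * (x⁻¹ - 1)) ≤ x ^ 2 * r * (q * (x⁻¹ - 1)) :=
    mul_le_mul_of_nonneg_right hw (by positivity)
  have c2 : x ^ 2 * r * (q * (x⁻¹ - 1)) = r * q * (x - x ^ 2) := by
    linear_combination x * r * q * hxx
  have c3 : (1 - x) ^ 2 * q * w ≤ (1 - x) ^ 2 * q * r :=
    mul_le_mul_of_nonneg_left hwr (by positivity)
  push_cast
  nlinarith

/-! ### Random sets grown one element at a time -/

/-- The number of elements of `W` that are smaller than `k`. -/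
def countBelow {n : ℕ} (k : ℕ) (W : Finset (Fin n)) : ℕ := (W.filter fun j => j.val < k).card

/-- `ν` is the law of a random subset of `{0, …, n - 1}` that contains `k` with conditional
probability `F w (k - w)`, given its elements below `k`, of which there are `w`. -/
structure IsGrowthLaw {n : ℕ} (F : ℕ → ℕ → ℝ) (ν : Finset (Fin n) → ℝ) : Prop where
  nonneg : ∀ W, 0 ≤ ν W
  sum_eq_one : ∑ W, ν W = 1
  sum_mem : ∀ (k : Fin n) (φ : Finset (Fin n) → ℝ),
    ∑ W, ν W * (φ (W.filter (· < k)) * if k ∈ W then 1 else 0) =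
      ∑ W, ν W * (φ (W.filter (· < k)) * F (countBelow k W) (k - countBelow k W))

section countBelow

variable {n : ℕ}

lemma countBelow_filter {j : ℕ} {k : Fin n} (hjk : j ≤ k) (W : Finset (Fin n)) :
    countBelow j (W.filter (· < k)) = countBelow j W := by
  rw [countBelow, countBelow, Finset.filter_filter]
  congr 1
  refine Finset.filter_congr fun i _ => ?_
  rw [Fin.lt_def]
  omega

lemma countBelow_zero (W : Finset (Fin n)) : countBelow 0 W = 0 := by
  simp [countBelow]

lemma countBelow_succ (k : Fin n) (W : Finset (Fin n)) :
    countBelow ((k : ℕ) + 1) W = countBelow k W + if k ∈ W then 1 else 0 := by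
  have : (W.filter fun j => j.val < (k : ℕ) + 1) =
      (W.filter fun j => j.val < (k : ℕ)) ∪ W.filter fun j => j = k := by
    rw [← Finset.filter_or]
    refine Finset.filter_congr fun i _ => ?_
    rw [Fin.ext_iff]
    omega
  rw [countBelow, this, Finset.card_union_of_disjoint, countBelow]
  · congr 1
    rw [Finset.filter_eq']
    split_ifs <;> simp
  · rw [Finset.disjoint_filter]
    rintro i _ h rfl
    omega

lemma countBelow_le (k : Fin n) (W : Finset (Fin n)) : countBelow k W ≤ k := by
  calc countBelow k W ≤ (Finset.Iio k).card := by
        refine Finset.card_le_card fun j hj => ?_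
        exact Finset.mem_Iio.2 (Finset.mem_filter.1 hj).2
    _ = k := by simp

end countBelow

namespace IsGrowthLaw

variable {n : ℕ} {F : ℕ → ℕ → ℝ} {ν : Finset (Fin n) → ℝ}

lemma sum_mono (h : IsGrowthLaw F ν) {φ ψ : Finset (Fin n) → ℝ} (H : ∀ W, φ W ≤ ψ W) :
    ∑ W, ν W * φ W ≤ ∑ W, ν W * ψ W :=
  Finset.sum_le_sum fun W _ => mul_le_mul_of_nonneg_left (H W) (h.nonneg W)

lemma sum_const (h : IsGrowthLaw F ν) (c : ℝ) : ∑ W, ν W * c = c := by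
  rw [← Finset.sum_mul, h.sum_eq_one, one_mul]

lemma sum_card (h : IsGrowthLaw F ν) :
    ∑ W, ν W * (W.card : ℝ) =
      ∑ k : Fin n, ∑ W, ν W * F (countBelow k W) (k - countBelow k W) := by
  have h1 : ∀ W : Finset (Fin n), (W.card : ℝ) = ∑ k, if k ∈ W then 1 else 0 := by
    intro W
    simp
  simp only [h1, Finset.mul_sum]
  rw [Finset.sum_comm]
  refine Finset.sum_congr rfl fun k _ => ?_
  simpa using h.sum_mem k fun _ => 1

lemma le_sum_card (h : IsGrowthLaw F ν) {l : ℕ → ℝ} (hl : ∀ w r, l (w + r) ≤ F w r) :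
    ∑ k ∈ Finset.range n, l k ≤ ∑ W, ν W * (W.card : ℝ) := by
  rw [h.sum_card, Finset.sum_range]
  refine Finset.sum_le_sum fun k _ => ?_
  rw [← h.sum_const (l k)]
  refine h.sum_mono fun W => ?_
  have := hl (countBelow k W) (k - countBelow k W)
  rwa [Nat.add_sub_cancel' (countBelow_le k W)] at this

/-! ### Supermartingale bound for staying sparse -/

/-- At no time from `m` on and before `k`, the fraction of elements exceeds `α`. -/
def SparseBetween (α : ℝ) (m k : ℕ) (W : Finset (Fin n)) : Prop :=
  ∀ j, m ≤ j → j < k → (countBelow j W : ℝ) ≤ α * j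

open Classical in
/-- An exponential supermartingale, stopped when the fraction of elements exceeds `α`. -/
def potential (α θ : ℝ) (m k : ℕ) (W : Finset (Fin n)) : ℝ :=
  if SparseBetween α m k W then Real.exp (θ * (countBelow k W - α * k)) else 0

lemma potential_nonneg (α θ : ℝ) (m k : ℕ) (W : Finset (Fin n)) : 0 ≤ potential α θ m k W := by
  unfold potential
  positivity

lemma sparseBetween_filter {α : ℝ} {m : ℕ} (k : Fin n) (W : Finset (Fin n)) :
    SparseBetween α m k (W.filter (· < k)) ↔ SparseBetween α m k W := by
  refine forall_congr' fun j => forall_congr' fun _ => forall_congr' fun hj => ?_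
  rw [countBelow_filter hj.le]

open Classical in
lemma potential_filter {α θ : ℝ} {m : ℕ} (k : Fin n) (W : Finset (Fin n)) :
    potential α θ m k (W.filter (· < k)) = potential α θ m k W := by
  unfold potential
  rw [countBelow_filter le_rfl]
  exact if_congr (sparseBetween_filter k W) rfl rfl

variable {α β : ℝ} {m : ℕ}

/-- This is the one-step factor of the potential with `θ = α - β`. By `exp θ - 1 ≤ θ + θ ^ 2`, the
exponent is at most `-θ * α + β * (θ + θ ^ 2) = -θ ^ 2 * (1 - β)`. -/
lemma one_add_mul_exp_sub_one_le (hβ : 0 ≤ β) (hβα : β < α) (hα : α ≤ 1) {x : ℝ} (hx : x ≤ β) :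
    Real.exp (-((α - β) * α)) * (1 + x * (Real.exp (α - β) - 1)) ≤
      Real.exp (-((α - β) ^ 2 * (1 - β))) := by
  set θ := α - β with hθ
  have h0 : 0 < θ := sub_pos.2 hβα
  have h1 : Real.exp θ - 1 ≤ θ + θ ^ 2 := by
    have := Real.abs_exp_sub_one_sub_id_le (x := θ) (by rw [abs_of_pos h0]; linarith)
    have := le_of_abs_le this
    linarith
  have h2 : 0 ≤ Real.exp θ - 1 := by
    have := Real.add_one_le_exp θ
    linarith
  have h3 : x * (Real.exp θ - 1) ≤ β * (θ + θ ^ 2) :=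
    (mul_le_mul_of_nonneg_right hx h2).trans (mul_le_mul_of_nonneg_left h1 hβ)
  have h4 : 1 + x * (Real.exp θ - 1) ≤ Real.exp (β * (θ + θ ^ 2)) := by
    linarith [Real.add_one_le_exp (β * (θ + θ ^ 2))]
  refine (mul_le_mul_of_nonneg_left h4 (Real.exp_nonneg _)).trans ?_
  rw [← Real.exp_add, Real.exp_le_exp]
  apply le_of_eq
  have : α = θ + β := by rw [hθ]; ring
  rw [this]
  ring

lemma sum_potential_succ_le (h : IsGrowthLaw F ν) (hβ : 0 ≤ β) (hβα : β < α) (hα : α ≤ 1)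
    (hF : ∀ w r : ℕ, (w + r < m ∨ (w : ℝ) ≤ α * (w + r : ℕ)) → F w r ≤ β) (k : Fin n) :
    ∑ W, ν W * potential α (α - β) m (k + 1) W ≤
      Real.exp (-((α - β) ^ 2 * (1 - β))) * ∑ W, ν W * potential α (α - β) m k W := by
  classical
  set θ := α - β with hθ
  -- `ψ` is the potential after step `k` if `k` is not added; adding `k` multiplies it by `exp θ`.
  -- It depends only on the past and vanishes once sparsity fails at time `k`, so `hF` applies
  -- wherever it is nonzero.
  set ψ : Finset (Fin n) → ℝ := fun W =>
    if (k : ℕ) < m ∨ (countBelow k W : ℝ) ≤ α * k then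
      Real.exp (-(θ * α)) * potential α θ m k W else 0 with hψ
  have hψf : ∀ W, ψ (W.filter (· < k)) = ψ W := fun W => by
    simp only [hψ, potential_filter, countBelow_filter le_rfl]
  have step : ∀ W, potential α θ m (k + 1) W ≤
      ψ (W.filter (· < k)) + (Real.exp θ - 1) * (ψ (W.filter (· < k)) * if k ∈ W then 1 else 0) := by
    intro W
    rw [hψf]
    by_cases hs : SparseBetween α m (k + 1) W
    · have hs' : SparseBetween α m k W := fun j h1 h2 => hs j h1 (h2.trans (Nat.lt_succ_self _))
      have hc : (k : ℕ) < m ∨ (countBelow k W : ℝ) ≤ α * k :=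
        (lt_or_ge _ _).imp_right fun hk => hs k hk (Nat.lt_succ_self _)
      simp only [hψ, potential, if_pos hs, if_pos hs', if_pos hc]
      rw [countBelow_succ, ← Real.exp_add]
      apply le_of_eq
      split_ifs
      · rw [show ∀ x : ℝ, x + (Real.exp θ - 1) * (x * 1) = Real.exp θ * x by intro x; ring,
          ← Real.exp_add]
        refine congrArg Real.exp ?_
        push_cast
        ring
      · rw [mul_zero, mul_zero, add_zero, add_zero]
        refine congrArg Real.exp ?_
        push_cast
        ring
    · rw [potential, if_neg hs]
      have h1 : 0 ≤ ψ W := by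
        have := potential_nonneg α θ m k W
        simp only [hψ]
        positivity
      have h2 : 0 ≤ Real.exp θ - 1 := by
        have := Real.add_one_le_exp θ
        have : 0 < θ := sub_pos.2 hβα
        linarith
      positivity
  calc ∑ W, ν W * potential α θ m (k + 1) W
      ≤ ∑ W, ν W * (ψ (W.filter (· < k)) +
          (Real.exp θ - 1) * (ψ (W.filter (· < k)) * if k ∈ W then 1 else 0)) := h.sum_mono step
    _ = ∑ W, ν W * (ψ W * (1 + F (countBelow k W) (k - countBelow k W) * (Real.exp θ - 1))) := by
        have := h.sum_mem k ψ
        simp only [mul_add, mul_left_comm (ν _) (Real.exp θ - 1), Finset.sum_add_distrib,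
          ← Finset.mul_sum]
        rw [this, Finset.mul_sum, ← Finset.sum_add_distrib, ← Finset.sum_add_distrib]
        refine Finset.sum_congr rfl fun W _ => ?_
        rw [hψf]
        ring
    _ ≤ ∑ W, ν W * (Real.exp (-(θ ^ 2 * (1 - β))) * potential α θ m k W) := by
        refine h.sum_mono fun W => ?_
        have hp := potential_nonneg α θ m k W
        simp only [hψ]
        split_ifs with hc
        · have hle := countBelow_le k W
          have hFβ : F (countBelow k W) (k - countBelow k W) ≤ β := by
            apply hF
            rwa [Nat.add_sub_cancel' hle]
          have := mul_le_mul_of_nonneg_right (one_add_mul_exp_sub_one_le hβ hβα hα hFβ) hp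
          rw [← hθ] at this
          linarith
        · rw [zero_mul]
          positivity
    _ = _ := by
        rw [Finset.mul_sum]
        exact Finset.sum_congr rfl fun W _ => by ring

lemma sum_potential_le (h : IsGrowthLaw F ν) (hβ : 0 ≤ β) (hβα : β < α) (hα : α ≤ 1)
    (hF : ∀ w r : ℕ, (w + r < m ∨ (w : ℝ) ≤ α * (w + r : ℕ)) → F w r ≤ β) {k : ℕ} (hk : k ≤ n) :
    ∑ W, ν W * potential α (α - β) m k W ≤ Real.exp (-((α - β) ^ 2 * (1 - β))) ^ k := by
  induction k with
  | zero =>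
    simp [potential, SparseBetween, countBelow_zero, h.sum_eq_one]
  | succ k ih =>
    have := h.sum_potential_succ_le hβ hβα hα hF ⟨k, hk⟩
    rw [pow_succ']
    exact this.trans (mul_le_mul_of_nonneg_left (ih (by omega)) (Real.exp_nonneg _))

open Classical in
-- At the first time `j ≥ m` of a violation, the potential has not yet been stopped and its exponent
-- is nonnegative, so this single term is at least `1`.
lemma indicator_le_sum_potential (hβα : β < α) {k : ℕ} (hk : m ≤ k) (W : Finset (Fin n)) :
    (if (countBelow k W : ℝ) ≤ α * k then 0 else 1) ≤
      ∑ j ∈ Finset.Icc m k, potential α (α - β) m j W := by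
  split_ifs with hc
  · exact Finset.sum_nonneg fun j _ => potential_nonneg _ _ _ _ _
  have hex : ∃ j, m ≤ j ∧ ¬ (countBelow j W : ℝ) ≤ α * j := ⟨k, hk, hc⟩
  set j := Nat.find hex with hj
  obtain ⟨h1, h2⟩ := Nat.find_spec hex
  have hjk : j ≤ k := Nat.find_min' hex ⟨hk, hc⟩
  have hs : SparseBetween α m j W := fun i hi hij => by
    by_contra hcon
    exact Nat.find_min hex hij ⟨hi, hcon⟩
  calc (1 : ℝ) ≤ potential α (α - β) m j W := by
        rw [potential, if_pos hs]
        exact Real.one_le_exp (mul_nonneg (sub_nonneg.2 hβα.le) (sub_nonneg.2 (not_le.1 h2).le))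
    _ ≤ _ := Finset.single_le_sum (f := fun j => potential α (α - β) m j W)
        (fun j _ => potential_nonneg _ _ _ _ _) (Finset.mem_Icc.2 ⟨h1, hjk⟩)

open Classical in
lemma sum_dense_le (h : IsGrowthLaw F ν) (hβ : 0 ≤ β) (hβα : β < α) (hα : α ≤ 1)
    (hF : ∀ w r : ℕ, (w + r < m ∨ (w : ℝ) ≤ α * (w + r : ℕ)) → F w r ≤ β) {k : ℕ} (hmk : m ≤ k)
    (hk : k ≤ n) :
    ∑ W, ν W * (if (countBelow k W : ℝ) ≤ α * k then 0 else 1) ≤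
      Real.exp (-((α - β) ^ 2 * (1 - β))) ^ m / (1 - Real.exp (-((α - β) ^ 2 * (1 - β)))) := by
  set e := Real.exp (-((α - β) ^ 2 * (1 - β))) with he
  have he0 : 0 ≤ e := Real.exp_nonneg _
  have he1 : e < 1 := by
    rw [he, Real.exp_lt_one_iff, neg_lt_zero]
    have := sub_pos.2 hβα
    have : 0 < 1 - β := by linarith
    positivity
  calc ∑ W, ν W * (if (countBelow k W : ℝ) ≤ α * k then 0 else 1)
      ≤ ∑ W, ν W * ∑ j ∈ Finset.Icc m k, potential α (α - β) m j W :=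
        h.sum_mono fun W => indicator_le_sum_potential hβα hmk W
    _ = ∑ j ∈ Finset.Icc m k, ∑ W, ν W * potential α (α - β) m j W := by
        simp only [Finset.mul_sum]
        exact Finset.sum_comm
    _ ≤ ∑ j ∈ Finset.Ico m (k + 1), e ^ j := by
        rw [← Finset.Ico_succ_right_eq_Icc]
        refine Finset.sum_le_sum fun j hj => ?_
        have := Finset.mem_Ico.1 hj
        exact h.sum_potential_le hβ hβα hα hF (by simp at this; omega)
    _ ≤ _ := geom_sum_Ico_le_of_lt_one he0 he1

/-- The three terms are the first `m` steps at cost at most `1` each, the probability `D` of being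
dense at each later step, and a geometric series from the sparse case. -/
lemma sum_card_le (h : IsGrowthLaw F ν) (hβ : 0 ≤ β) (hβα : β < α) (hα : α ≤ 1)
    (hF : ∀ w r : ℕ, (w + r < m ∨ (w : ℝ) ≤ α * (w + r : ℕ)) → F w r ≤ β)
    (hF1 : ∀ w r, F w r ≤ 1) {C κ : ℝ} (hC : 0 ≤ C) (hκ : 0 < κ)
    (hFC : ∀ w r : ℕ, (w : ℝ) ≤ α * (w + r : ℕ) → F w r ≤ C * Real.exp (-(κ * (w + r : ℕ)))) :
    ∑ W, ν W * (W.card : ℝ) ≤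
      m + n * (Real.exp (-((α - β) ^ 2 * (1 - β))) ^ m /
        (1 - Real.exp (-((α - β) ^ 2 * (1 - β))))) + C * (1 / (1 - Real.exp (-κ))) := by
  classical
  set D := Real.exp (-((α - β) ^ 2 * (1 - β))) ^ m /
    (1 - Real.exp (-((α - β) ^ 2 * (1 - β)))) with hD
  have hD0 : 0 ≤ D := by
    have : Real.exp (-((α - β) ^ 2 * (1 - β))) ≤ 1 := by
      rw [Real.exp_le_one_iff, neg_nonpos]
      have : 0 < 1 - β := by linarith
      positivity
    have := sub_nonneg.2 this
    positivity
  have hterm : ∀ k : Fin n, ∑ W, ν W * F (countBelow k W) (k - countBelow k W) ≤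
      (if (k : ℕ) < m then 1 else 0) + D + C * Real.exp (-κ) ^ (k : ℕ) := by
    intro k
    have hE : 0 ≤ C * Real.exp (-κ) ^ (k : ℕ) := by positivity
    split_ifs with hk
    · have : ∑ W, ν W * F (countBelow k W) (k - countBelow k W) ≤ 1 := by
        rw [← h.sum_const 1]
        exact h.sum_mono fun W => hF1 _ _
      linarith
    · have h1 := h.sum_dense_le hβ hβα hα hF (not_lt.1 hk) k.2.le
      rw [← hD] at h1
      have h2 : ∑ W, ν W * F (countBelow k W) (k - countBelow k W) ≤
          ∑ W, ν W * ((if (countBelow k W : ℝ) ≤ α * k then 0 else 1) +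
            C * Real.exp (-κ) ^ (k : ℕ)) := by
        refine h.sum_mono fun W => ?_
        have hle := Nat.add_sub_cancel' (countBelow_le k W)
        split_ifs with hc
        · have := hFC (countBelow k W) (k - countBelow k W) (by rwa [hle])
          rw [hle] at this
          rw [zero_add, ← Real.exp_nat_mul]
          convert this using 3
          ring
        · have := hF1 (countBelow k W) (k - countBelow k W)
          linarith
      simp only [mul_add, Finset.sum_add_distrib] at h2
      simp only [h.sum_const] at h2
      linarith
  have hκ1 : Real.exp (-κ) < 1 := by rw [Real.exp_lt_one_iff]; linarith
  rw [h.sum_card]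
  refine (Finset.sum_le_sum fun k _ => hterm k).trans ?_
  rw [Finset.sum_add_distrib, Finset.sum_add_distrib, ← Finset.mul_sum]
  have hgeom : ∑ k : Fin n, Real.exp (-κ) ^ (k : ℕ) ≤ 1 / (1 - Real.exp (-κ)) := by
    rw [← Finset.sum_range fun k => Real.exp (-κ) ^ k, Finset.range_eq_Ico]
    simpa using geom_sum_Ico_le_of_lt_one (m := 0) (n := n) (Real.exp_nonneg _) hκ1
  have hm : ∑ k : Fin n, (if (k : ℕ) < m then (1 : ℝ) else 0) ≤ m := by
    rw [← Finset.sum_range fun k => if k < m then (1 : ℝ) else 0, ← Finset.sum_filter,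
      Finset.sum_const, nsmul_eq_mul, mul_one]
    have : ((Finset.range n).filter (· < m)).card ≤ (Finset.range m).card :=
      Finset.card_le_card fun i hi => by simpa using (Finset.mem_filter.1 hi).2
    rw [Finset.card_range] at this
    exact_mod_cast this
  have hDn : ∑ _k : Fin n, D = n * D := by simp
  rw [hDn]
  have := mul_le_mul_of_nonneg_left hgeom hC
  linarith

end IsGrowthLaw

/-! ### Independent random subsets as finite sums -/

/-- The expectation of `g S`, where the random subset `S` of `U` contains each element of `U`
independently with probability `q`. -/
def subsetExp {κ : Type*} (q : ℝ) (U : Finset κ) (g : Finset κ → ℝ) : ℝ :=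
  ∑ S ∈ U.powerset, q ^ S.card * (1 - q) ^ (U.card - S.card) * g S

section subsetExp

variable {κ κ' : Type*} {q r : ℝ}

lemma subsetExp_congr {U : Finset κ} {g h : Finset κ → ℝ} (H : ∀ S ⊆ U, g S = h S) :
    subsetExp q U g = subsetExp q U h :=
  Finset.sum_congr rfl fun S hS => by rw [H S (Finset.mem_powerset.1 hS)]

lemma subsetExp_nonneg (hq : 0 ≤ q) (hq1 : q ≤ 1) {U : Finset κ} {g : Finset κ → ℝ}
    (H : ∀ S, 0 ≤ g S) : 0 ≤ subsetExp q U g := by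
  have := sub_nonneg.2 hq1
  exact Finset.sum_nonneg fun S _ => mul_nonneg (by positivity) (H S)

lemma subsetExp_const (U : Finset κ) (x : ℝ) : subsetExp q U (fun _ => x) = x := by
  rw [subsetExp, ← Finset.sum_mul, Finset.sum_pow_mul_eq_add_pow]
  simp

lemma subsetExp_const_mul (U : Finset κ) (x : ℝ) (g : Finset κ → ℝ) :
    subsetExp q U (fun S => x * g S) = x * subsetExp q U g := by
  rw [subsetExp, subsetExp, Finset.mul_sum]
  exact Finset.sum_congr rfl fun S _ => by ring

lemma subsetExp_sum {ι : Type*} (I : Finset ι) (U : Finset κ) (g : ι → Finset κ → ℝ) :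
    ∑ i ∈ I, subsetExp q U (g i) = subsetExp q U fun S => ∑ i ∈ I, g i S := by
  simp only [subsetExp, Finset.mul_sum]
  exact Finset.sum_comm

lemma subsetExp_comm (U : Finset κ) (V : Finset κ') (g : Finset κ → Finset κ' → ℝ) :
    subsetExp q U (fun S => subsetExp r V fun T => g S T) =
      subsetExp r V fun T => subsetExp q U fun S => g S T := by
  simp only [subsetExp, Finset.mul_sum]
  rw [Finset.sum_comm]
  exact Finset.sum_congr rfl fun T _ => Finset.sum_congr rfl fun S _ => by ring

lemma subsetExp_empty (g : Finset κ → ℝ) : subsetExp q ∅ g = g ∅ := by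
  simp [subsetExp]

variable [DecidableEq κ]

lemma subsetExp_insert {a : κ} {U : Finset κ} (ha : a ∉ U) (g : Finset κ → ℝ) :
    subsetExp q (insert a U) g =
      q * subsetExp q U (fun S => g (insert a S)) + (1 - q) * subsetExp q U g := by
  rw [subsetExp, Finset.sum_powerset_insert ha, add_comm, subsetExp, subsetExp, Finset.mul_sum,
    Finset.mul_sum]
  congr 1
  · refine Finset.sum_congr rfl fun S hS => ?_
    have : a ∉ S := fun h => ha (Finset.mem_powerset.1 hS h)
    rw [Finset.card_insert_of_notMem ha, Finset.card_insert_of_notMem this, Nat.add_sub_add_right]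
    ring
  · refine Finset.sum_congr rfl fun S hS => ?_
    have := Finset.card_le_card (Finset.mem_powerset.1 hS)
    rw [Finset.card_insert_of_notMem ha, Nat.succ_sub this, pow_succ]
    ring

lemma subsetExp_singleton (a : κ) (g : Finset κ → ℝ) :
    subsetExp q {a} g = q * g {a} + (1 - q) * g ∅ := by
  rw [← insert_empty_eq, subsetExp_insert (Finset.notMem_empty a), subsetExp_empty, subsetExp_empty]

lemma subsetExp_union {U V : Finset κ} (hUV : Disjoint U V) (g : Finset κ → ℝ) :
    subsetExp q (U ∪ V) g = subsetExp q U fun S => subsetExp q V fun T => g (S ∪ T) := by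
  induction U using Finset.induction_on generalizing g with
  | empty => simp [subsetExp_empty]
  | insert a U ha ih =>
    rw [Finset.disjoint_insert_left] at hUV
    rw [Finset.insert_union, subsetExp_insert (by simp [ha, hUV.1]), ih hUV.2, ih hUV.2,
      subsetExp_insert ha]
    simp only [Finset.insert_union]

lemma subsetExp_map [DecidableEq κ'] (e : κ ↪ κ') (U : Finset κ) (g : Finset κ' → ℝ) :
    subsetExp q (U.map e) g = subsetExp q U fun S => g (S.map e) := by
  induction U using Finset.induction_on generalizing g with
  | empty => simp [subsetExp_empty]
  | insert a U ha ih =>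
    rw [Finset.map_insert, subsetExp_insert (by simpa using ha), ih, ih, subsetExp_insert ha]
    simp only [Finset.map_insert]

/-- The parts of `S` inside and outside `P` are independent, so their sizes are independent
binomials. -/
lemma subsetExp_card_inter {U P : Finset κ} (hP : P ⊆ U) (g : ℕ → ℕ → ℝ) :
    subsetExp q U (fun S => g (S ∩ P).card (S \ P).card) =
      binExp q P.card (U.card - P.card) g := by
  have hU : P ∪ U \ P = U := Finset.union_sdiff_of_subset hP
  conv_lhs => rw [← hU]
  rw [subsetExp_union Finset.disjoint_sdiff, ← Finset.card_sdiff_of_subset hP]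
  have h1 : ∀ S ⊆ P, subsetExp q (U \ P) (fun T => g ((S ∪ T) ∩ P).card ((S ∪ T) \ P).card) =
      subsetExp q (U \ P) fun T => g S.card T.card := fun S hS => by
    refine subsetExp_congr fun T hT => ?_
    have hTP : Disjoint T P := Finset.disjoint_of_subset_left hT Finset.sdiff_disjoint
    congr 2
    · rw [Finset.union_inter_distrib_right, Finset.inter_eq_left.2 hS,
        Finset.disjoint_iff_inter_eq_empty.1 hTP, Finset.union_empty]
    · rw [Finset.union_sdiff_distrib, Finset.sdiff_eq_empty_iff_subset.2 hS,
        Finset.sdiff_eq_self_of_disjoint hTP, Finset.empty_union]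
  rw [subsetExp_congr h1]
  have h2 : ∀ (V : Finset κ) (f : ℕ → ℝ), subsetExp q V (fun T => f T.card) =
      ∑ c ∈ Finset.range (V.card + 1), binWeight q V.card c * f c := fun V f => by
    rw [subsetExp, Finset.sum_powerset_apply_card
      fun c => q ^ c * (1 - q) ^ (V.card - c) * f c]
    exact Finset.sum_congr rfl fun c _ => by rw [nsmul_eq_mul, binWeight]; ring
  simp only [h2 (U \ P)]
  rw [h2 P fun a => ∑ c ∈ Finset.range ((U \ P).card + 1), binWeight q (U \ P).card c * g a c]
  rw [binExp]
  refine Finset.sum_congr rfl fun a _ => ?_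
  rw [Finset.mul_sum]
  exact Finset.sum_congr rfl fun c _ => by ring

end subsetExp

/-! ### Dependence of a decision on the past, and the majority rule -/

section decision

variable {n : ℕ}

/-- The set of nodes whose decision is wrong. -/
def wrongSet (b : Bool) (G : SimpleGraph (Fin n)) (s : Fin n → Bool) : Finset (Fin n) :=
  Finset.univ.filter fun i => decision (majority G) s i ≠ b

lemma decision_congr {G G' : SimpleGraph (Fin n)} {s s' : Fin n → Bool} {k : Fin n}
    (hG : ∀ i j, i < k → j < k → (G.Adj i j ↔ G'.Adj i j)) (hs : ∀ i < k, s i = s' i)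
    (i : Fin n) (hi : i < k) : decision (majority G) s i = decision (majority G') s' i := by
  induction i using WellFoundedLT.induction with
  | ind i ih =>
    rw [decision, decision, hs i hi, majority, majority]
    have h1 : (fun j : Fin i => decision (majority G) s ⟨j, j.2.trans i.2⟩) =
        fun j : Fin i => decision (majority G') s' ⟨j, j.2.trans i.2⟩ := by
      funext j
      have hj : (⟨j, j.2.trans i.2⟩ : Fin n) < i := j.2
      exact ih _ hj (hj.trans hi)
    have h2 : ∀ j : Fin i, G.Adj ⟨j, j.2.trans i.2⟩ i ↔ G'.Adj ⟨j, j.2.trans i.2⟩ i := fun j =>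
      hG _ _ (lt_trans (show (⟨j, j.2.trans i.2⟩ : Fin n) < i from j.2) hi) hi
    classical
    simp only [h1]
    rw [Finset.filter_congr fun j _ => h2 j]

lemma wrongSet_filter_congr (b : Bool) {G G' : SimpleGraph (Fin n)} {s s' : Fin n → Bool}
    {k : Fin n} (hG : ∀ i j, i < k → j < k → (G.Adj i j ↔ G'.Adj i j))
    (hs : ∀ i < k, s i = s' i) :
    (wrongSet b G s).filter (· < k) = (wrongSet b G' s').filter (· < k) := by
  ext i
  simp only [wrongSet, Finset.mem_filter, Finset.mem_univ, true_and]
  refine and_congr_left fun hi => ?_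
  rw [decision_congr hG hs i hi]

lemma count_map_val_cons {ι : Type*} (A : Finset ι) (c : ι → Bool) (x s : Bool) :
    (s ::ₘ A.val.map c).count x = (A.filter fun j => c j = x).card + if x = s then 1 else 0 := by
  rw [Multiset.count_cons, Multiset.count_map, Finset.card_def, Finset.filter_val]
  simp only [eq_comm]

/-- The node's own signal is one vote and also wins ties, so overruling it takes a surplus of two
opposing neighbours. -/
lemma maj_ne_iff {ι : Type*} (A : Finset ι) (c : ι → Bool) (s b : Bool) :
    maj (A.val.map c) s ≠ b ↔
      if s = b then (A.filter fun j => ¬ c j ≠ b).card + 2 ≤ (A.filter fun j => c j ≠ b).card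
      else (A.filter fun j => ¬ c j ≠ b).card ≤ (A.filter fun j => c j ≠ b).card + 1 := by
  rw [maj, count_map_val_cons, count_map_val_cons]
  rcases s with _ | _ <;> rcases b with _ | _ <;> simp <;> omega

open Classical in
/-- The local rule of the Majority Algorithm in terms of the set of wrong nodes. -/
lemma mem_wrongSet_iff (b : Bool) (G : SimpleGraph (Fin n)) (s : Fin n → Bool) (k : Fin n)
    {P N : Finset (Fin n)} (hP : (wrongSet b G s).filter (· < k) = P)
    (hN : ∀ j, j ∈ N ↔ j < k ∧ G.Adj j k) :
    k ∈ wrongSet b G s ↔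
      if s k = b then (N \ P).card + 2 ≤ (N ∩ P).card else (N \ P).card ≤ (N ∩ P).card + 1 := by
  have hcard : ∀ (f : Fin n → Prop) [DecidablePred f],
      ((Finset.univ.filter fun j : Fin k => G.Adj ⟨j, j.2.trans k.2⟩ k).filter
        fun j : Fin k => f ⟨j, j.2.trans k.2⟩).card = (N.filter f).card := fun f _ => by
    refine Finset.card_bij (fun j _ => ⟨j, j.2.trans k.2⟩) (fun j hj => ?_) (fun i _ j _ h => ?_)
      fun j hj => ?_
    · simp only [Finset.mem_filter, Finset.mem_univ, true_and] at hj
      rw [Finset.mem_filter, hN]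
      exact ⟨⟨j.2, hj.1⟩, hj.2⟩
    · exact Fin.ext (by simpa using h)
    · rw [Finset.mem_filter, hN] at hj
      exact ⟨⟨j, hj.1.1⟩, by simpa using ⟨hj.1.2, hj.2⟩, rfl⟩
  have hmem : ∀ j ∈ N, (j ∈ P ↔ decision (majority G) s j ≠ b) := fun j hj => by
    rw [← hP, Finset.mem_filter, wrongSet, Finset.mem_filter]
    simp [((hN j).1 hj).1]
  have h1 : N ∩ P = N.filter fun j => decision (majority G) s j ≠ b := by
    ext j
    rw [Finset.mem_inter, Finset.mem_filter]
    exact and_congr_right fun h => hmem j h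
  have h2 : N \ P = N.filter fun j => ¬ decision (majority G) s j ≠ b := by
    ext j
    rw [Finset.mem_sdiff, Finset.mem_filter]
    exact and_congr_right fun h => not_congr (hmem j h)
  rw [wrongSet, Finset.mem_filter, decision, majority, maj_ne_iff, h1, h2,
    hcard fun j => ¬ decision (majority G) s j ≠ b, hcard fun j => decision (majority G) s j ≠ b]
  simp

end decision

/-! ### The wrong nodes form a growth process -/

section model

variable {n : ℕ}

/-- The unordered pairs of different nodes. -/
def pairs (n : ℕ) : Finset (Sym2 (Fin n)) := Finset.univ.filter fun e => ¬ e.IsDiag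

/-- The signals when `b` is the truth and `T` is the set of nodes with a wrong signal. -/
def signals (b : Bool) (T : Finset (Fin n)) (i : Fin n) : Bool := if i ∈ T then !b else b

lemma integral_binomialRandom (q : unitInterval) (h : SimpleGraph (Fin n) → ℝ) :
    ∫ G, h G ∂(SimpleGraph.binomialRandom (Fin n) q) =
      subsetExp q (pairs n) fun S => h (SimpleGraph.fromEdgeSet (S : Set (Sym2 (Fin n)))) := by
  classical
  have hcard : (pairs n).card = n.choose 2 := by
    have := Sym2.card_subtype_not_diag (α := Fin n)
    rw [Fintype.card_fin, Fintype.card_subtype] at this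
    exact this
  rw [integral_fintype .of_finite, subsetExp]
  refine Finset.sum_bij' (fun G _ => G.edgeFinset)
    (fun S _ => SimpleGraph.fromEdgeSet (S : Set (Sym2 (Fin n)))) ?_ ?_ ?_ ?_ ?_
  · intro G _
    rw [Finset.mem_powerset]
    intro e he
    simp only [pairs, Finset.mem_filter, Finset.mem_univ, true_and]
    exact G.not_isDiag_of_mem_edgeFinset he
  · simp
  · intro G _
    simp
  · intro S hS
    ext e
    have := Finset.mem_powerset.1 hS
    simp only [SimpleGraph.mem_edgeFinset, SimpleGraph.edgeSet_fromEdgeSet, Set.mem_sdiff,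
      Finset.mem_coe]
    refine ⟨fun h => h.1, fun h => ⟨h, ?_⟩⟩
    simpa [pairs] using this h
  · intro G _
    simp only [SimpleGraph.coe_edgeFinset, SimpleGraph.fromEdgeSet_edgeSet]
    rw [measureReal_def, SimpleGraph.binomialRandom_singleton, hcard, smul_eq_mul, Nat.card_fin,
      ← SimpleGraph.coe_edgeFinset, Set.ncard_coe_finset]
    simp

lemma integral_signalLaw (p : unitInterval) (b : Bool) (h : (Fin n → Bool) → ℝ) :
    ∫ s, h s ∂(signalLaw n p b) =
      subsetExp (1 - p) Finset.univ fun T => h (signals b T) := by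
  classical
  have : IsProbabilityMeasure (signalLaw n p b) := by unfold signalLaw; infer_instance
  rw [integral_fintype .of_finite, subsetExp]
  refine Finset.sum_bij' (fun s _ => Finset.univ.filter fun i => s i ≠ b)
    (fun T _ => signals b T) ?_ ?_ ?_ ?_ ?_
  · simp
  · simp
  · intro s _
    funext i
    simp only [signals, Finset.mem_filter, Finset.mem_univ, true_and]
    cases s i <;> cases b <;> simp
  · intro T _
    ext i
    rw [Finset.mem_filter]
    by_cases hi : i ∈ T <;> simp [signals, hi]
  · intro s _
    have hs : signals b (Finset.univ.filter fun i => s i ≠ b) = s := by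
      funext i
      simp only [signals, Finset.mem_filter, Finset.mem_univ, true_and]
      cases s i <;> cases b <;> simp
    rw [hs, smul_eq_mul, measureReal_def, signalLaw, Measure.pi_singleton, ENNReal.toReal_prod]
    congr 1
    have : ∀ i, ((ProbabilityTheory.bernoulliMeasure b (!b) p) {s i}).toReal =
        if s i ≠ b then (1 - p : ℝ) else p := fun i => by
      rw [← measureReal_def, ProbabilityTheory.bernoulliMeasure_real_apply p (by measurability)]
      cases s i <;> cases b <;> simp
    simp only [this]
    rw [Finset.prod_ite, Finset.prod_const, Finset.prod_const]
    congr 2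
    · ring
    · rw [Finset.filter_not, Finset.card_sdiff_of_subset (Finset.filter_subset _ _)]

/-- The law of the set of wrong nodes. -/
def wrongLaw (n : ℕ) (q p : ℝ) (b : Bool) (W : Finset (Fin n)) : ℝ :=
  subsetExp q (pairs n) fun S => subsetExp (1 - p) Finset.univ fun T =>
    if W = wrongSet b (SimpleGraph.fromEdgeSet (S : Set (Sym2 (Fin n)))) (signals b T) then 1 else 0

lemma sum_wrongLaw (q p : ℝ) (b : Bool) (φ : Finset (Fin n) → ℝ) :
    ∑ W, wrongLaw n q p b W * φ W =
      subsetExp q (pairs n) fun S => subsetExp (1 - p) Finset.univ fun T =>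
        φ (wrongSet b (SimpleGraph.fromEdgeSet (S : Set (Sym2 (Fin n)))) (signals b T)) := by
  simp only [wrongLaw, mul_comm _ (φ _), ← subsetExp_const_mul]
  simp only [subsetExp_sum]
  simp

lemma expectedWrongRandomGraph_eq (q p : unitInterval) (b : Bool) :
    expectedWrongRandomGraph n q p b = ∑ W, wrongLaw n q p b W * (W.card : ℝ) := by
  rw [sum_wrongLaw, expectedWrongRandomGraph, integral_binomialRandom]
  simp only [expectedWrong, integral_signalLaw]
  rfl

/-- The pairs that consist of `k` and another element. -/
def pairWith (k : Fin n) : Fin n ↪ Sym2 (Fin n) :=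
  ⟨fun j => s(j, k), fun i j h => by
    have : i = j ∨ i = k ∧ k = j := by simpa using h
    exact this.elim id fun h => h.1.trans h.2⟩

/-- Exposing the edges from `k` to smaller nodes and the signal of `k` last. -/
lemma subsetExp_expose_last (q r : ℝ) (k : Fin n)
    (Φ : Finset (Sym2 (Fin n)) → Finset (Fin n) → ℝ) :
    (subsetExp q (pairs n) fun S => subsetExp r Finset.univ fun T => Φ S T) =
      subsetExp q (pairs n \ (Finset.Iio k).map (pairWith k)) fun S =>
        subsetExp r (Finset.univ.erase k) fun T =>
          subsetExp q (Finset.Iio k) fun N => subsetExp r {k} fun T' =>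
            Φ (S ∪ N.map (pairWith k)) (T ∪ T') := by
  have hsub : (Finset.Iio k).map (pairWith k) ⊆ pairs n := by
    intro e he
    obtain ⟨j, hj, rfl⟩ := Finset.mem_map.1 he
    exact Finset.mem_filter.2 ⟨Finset.mem_univ _,
      fun h => (Finset.mem_Iio.1 hj).ne (Sym2.mk_isDiag_iff.1 h)⟩
  conv_lhs => rw [← Finset.sdiff_union_of_subset hsub]
  rw [subsetExp_union Finset.sdiff_disjoint]
  refine subsetExp_congr fun S _ => ?_
  rw [subsetExp_map, subsetExp_comm (Finset.univ.erase k)]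
  refine subsetExp_congr fun N _ => ?_
  have hk : (Finset.univ : Finset (Fin n)) = Finset.univ.erase k ∪ {k} := by
    ext i
    by_cases h : i = k <;> simp [h]
  conv_lhs => rw [hk]
  rw [subsetExp_union (by simp)]

/-- With all other edges and signals fixed, the wrong nodes `P` below `k` are determined, while the
edges from `k` downwards and the signal of `k` are still fresh. Edges from `k` upwards affect
neither `P` nor the decision of `k`. -/
lemma isGrowthLaw_wrongLaw {q p : ℝ} (hq : 0 ≤ q) (hq1 : q ≤ 1) (hp : 0 ≤ p) (hp1 : p ≤ 1)
    (b : Bool) : IsGrowthLaw (wrongProb q p) (wrongLaw n q p b) where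
  nonneg W := subsetExp_nonneg hq hq1 fun S =>
    subsetExp_nonneg (by linarith) (by linarith) fun T => by positivity
  sum_eq_one := by
    simpa [subsetExp_const] using sum_wrongLaw (n := n) q p b fun _ => 1
  sum_mem k φ := by
    classical
    rw [sum_wrongLaw q p b fun W => φ (W.filter (· < k)) * if k ∈ W then 1 else 0,
      sum_wrongLaw q p b fun W =>
        φ (W.filter (· < k)) * wrongProb q p (countBelow k W) (k - countBelow k W),
      subsetExp_expose_last q (1 - p) k, subsetExp_expose_last q (1 - p) k]
    refine subsetExp_congr fun S hS => subsetExp_congr fun T hT => ?_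
    set P := (wrongSet b (SimpleGraph.fromEdgeSet (S : Set (Sym2 (Fin n)))) (signals b T)).filter
      (· < k) with hPdef
    have hpast : ∀ N ⊆ Finset.Iio k, ∀ T' ⊆ {k},
        (wrongSet b (SimpleGraph.fromEdgeSet ((S ∪ N.map (pairWith k) : Finset _) : Set _))
          (signals b (T ∪ T'))).filter (· < k) = P := by
      intro N hN T' hT'
      refine wrongSet_filter_congr b (fun i j hi hj => ?_) fun i hi => ?_
      · simp only [SimpleGraph.fromEdgeSet_adj, Finset.mem_coe, Finset.mem_union]
        refine and_congr_left fun _ => or_iff_left fun h => ?_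
        obtain ⟨l, -, hl⟩ := Finset.mem_map.1 h
        have : k ∈ s(i, j) := by rw [← hl]; exact Sym2.mem_mk_right _ _
        rcases Sym2.mem_iff.1 this with rfl | rfl
        · exact lt_irrefl _ hi
        · exact lt_irrefl _ hj
      · have : i ∉ T' := fun h => hi.ne (Finset.mem_singleton.1 (hT' h))
        simp [signals, this]
    have hPk : P ⊆ Finset.Iio k := fun i hi => Finset.mem_Iio.2 (Finset.mem_filter.1 hi).2
    have hcount : ∀ W : Finset (Fin n), countBelow k W = (W.filter (· < k)).card := fun W => rfl
    have hR : ∀ N ⊆ Finset.Iio k, ∀ T' ⊆ {k},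
        k ∈ wrongSet b (SimpleGraph.fromEdgeSet ((S ∪ N.map (pairWith k) : Finset _) : Set _))
          (signals b (T ∪ T')) ↔
        if k ∈ T' then (N \ P).card ≤ (N ∩ P).card + 1 else (N \ P).card + 2 ≤ (N ∩ P).card := by
      intro N hN T' hT'
      rw [mem_wrongSet_iff b _ _ k (hpast N hN T' hT') (N := N)]
      · have hkT : k ∉ T := fun h => (Finset.mem_erase.1 (hT h)).1 rfl
        by_cases h : k ∈ T' <;> simp [signals, h, hkT]
      · intro j
        simp only [SimpleGraph.fromEdgeSet_adj, Finset.mem_coe, Finset.mem_union]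
        constructor
        · intro hj
          have hjk := Finset.mem_Iio.1 (hN hj)
          exact ⟨hjk, Or.inr (Finset.mem_map_of_mem (pairWith k) hj), hjk.ne⟩
        · rintro ⟨hjk, h | h, -⟩
          · exact absurd (Finset.mem_map_of_mem (pairWith k) (Finset.mem_Iio.2 hjk))
              (Finset.mem_sdiff.1 (hS h)).2
          · exact (Finset.mem_map' (pairWith k)).1 h
    calc _ = subsetExp q (Finset.Iio k) fun N => φ P * wrongGiven p (N ∩ P).card (N \ P).card := by
          refine subsetExp_congr fun N hN => ?_
          rw [subsetExp_singleton, hpast N hN _ subset_rfl, hpast N hN _ (by simp)]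
          simp only [hR N hN _ subset_rfl, hR N hN ∅ (by simp), Finset.mem_singleton,
            Finset.notMem_empty, if_true, if_false, wrongGiven]
          ring
      _ = φ P * wrongProb q p P.card (k - P.card) := by
          rw [subsetExp_const_mul, subsetExp_card_inter hPk, Fin.card_Iio]
          rfl
      _ = _ := by
          symm
          -- The other integrand depends only on `P`, so averaging over the fresh randomness leaves
          -- it unchanged.
          rw [← subsetExp_const (q := q) (Finset.Iio k)
            (φ P * wrongProb q p P.card (k - P.card))]
          refine subsetExp_congr fun N hN => ?_
          rw [subsetExp_singleton, hcount, hcount, hpast N hN _ subset_rfl,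
            hpast N hN _ (by simp)]
          ring

end model

/-! ### Upper and lower bounds in terms of `q` -/

lemma one_div_one_sub_exp_neg_le {κ : ℝ} (hκ : 0 < κ) (hκ1 : κ ≤ 1) :
    1 / (1 - Real.exp (-κ)) ≤ 2 / κ := by
  have h1 : Real.exp (-κ) ≤ 1 / (1 + κ) := by
    rw [Real.exp_neg, ← one_div]
    exact one_div_le_one_div_of_le (by linarith) (by linarith [Real.add_one_le_exp κ])
  have h2 : 1 / (1 + κ) ≤ 1 - κ / 2 := by
    rw [div_le_iff₀ (by linarith)]
    nlinarith
  calc 1 / (1 - Real.exp (-κ)) ≤ 1 / (κ / 2) :=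
        one_div_le_one_div_of_le (by linarith) (by linarith)
    _ = 2 / κ := one_div_div _ _

/-- If the majority of the signals is right, the Majority Algorithm errs only `O(1 / q)` times
in expectation, unless the connection probability `q` is too large. -/
lemma exists_expectedWrongRandomGraph_le (p : unitInterval) (hp : (1 / 2 : ℝ) < p)
    (hp1 : (p : ℝ) < 1) :
    ∃ A B c : ℝ, 0 < A ∧ 0 < B ∧ 0 < c ∧ ∀ (n : ℕ) (q : unitInterval) (b : Bool), 0 < (q : ℝ) →
      expectedWrongRandomGraph n q p b ≤ A / q + B * (n * Real.exp (-(c / q))) := by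
  have hp0 : (0 : ℝ) < p := by linarith
  set ρ : ℝ := √((1 - p) / p) with hρ
  have hρ2 : p * ρ ^ 2 = 1 - p := by
    rw [hρ, Real.sq_sqrt (div_nonneg (by linarith) hp0.le)]
    field_simp
  have hρ0 : 0 < ρ := Real.sqrt_pos.2 (div_pos (by linarith) hp0)
  have hρ1 : ρ < 1 := by
    by_contra! h
    nlinarith
  -- With `x ^ 2 = ρ`, both bounds for the sparse case have the same hypothesis `w ≤ ρ * r`; `α`
  -- below is the fraction of wrong nodes at ratio `ρ`.
  set x : ℝ := √ρ with hx
  have hx2 : x ^ 2 = ρ := Real.sq_sqrt hρ0.le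
  have hx0 : 0 < x := Real.sqrt_pos.2 hρ0
  have hx1 : x < 1 := by
    by_contra! h
    nlinarith
  set α : ℝ := ρ / (1 + ρ) with hα
  have hα1 : α ≤ 1 := by
    rw [hα, div_le_one (by linarith)]
    linarith
  -- Here `1 - p = ρ ^ 2 / (1 + ρ ^ 2)`, which is below `ρ / (1 + ρ)` as `0 < ρ < 1`. This gap
  -- leaves room for `β` and `δ`.
  have hpα : 1 - p < α := by
    rw [hα, lt_div_iff₀ (by linarith)]
    nlinarith [mul_pos hρ0 (sub_pos.2 hρ1)]
  have hαρ : ∀ w r : ℕ, (w : ℝ) ≤ α * (w + r : ℕ) → (w : ℝ) ≤ ρ * r := fun w r h => by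
    rw [hα, div_mul_eq_mul_div, le_div_iff₀ (by linarith)] at h
    push_cast at h
    linarith
  set β : ℝ := (1 - p + α) / 2 with hβ
  have hβα : β < α := by linarith
  have hβ0 : 0 ≤ β := by linarith
  set δ : ℝ := β - (1 - p) with hδ
  have hδ0 : 0 < δ := by linarith
  set η : ℝ := (α - β) ^ 2 * (1 - β) with hη
  have hη0 : 0 < η := mul_pos (pow_pos (sub_pos.2 hβα) 2) (by linarith)
  have hη1 : Real.exp (-η) < 1 := by rw [Real.exp_lt_one_iff]; linarith
  have hx3 : 0 < 1 - x := sub_pos.2 hx1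
  refine ⟨(δ + 1) + x⁻¹ * (2 / ((1 - x) ^ 2 / 2)), 1 / (1 - Real.exp (-η)), η * δ, by positivity,
    one_div_pos.2 (sub_pos.2 hη1), by positivity, fun n q b hq => ?_⟩
  have hq1 : (q : ℝ) ≤ 1 := q.2.2
  set κ : ℝ := (1 - x) ^ 2 / 2 * q with hκ
  have hκ0 : 0 < κ := by positivity
  have hκ1 : κ ≤ 1 := by
    have : (1 - x) ^ 2 ≤ 1 := pow_le_one₀ hx3.le (by linarith)
    exact mul_le_one₀ (by linarith) hq.le hq1
  -- An index below `m` is at most `δ / q`, so its error probability is at most `1 - p + δ = β`; and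
  -- `m ≥ δ / q` turns `exp (-η) ^ m` into `exp (-(η * δ / q))`.
  set m : ℕ := ⌊δ / q⌋₊ + 1 with hm
  have hm1 : δ / q ≤ m := by
    rw [hm]
    push_cast
    exact (Nat.lt_floor_add_one _).le
  have hm2 : (m : ℝ) ≤ (δ + 1) / q := by
    rw [hm]
    push_cast
    have h1 := Nat.floor_le (show 0 ≤ δ / q by positivity)
    have h2 : 1 ≤ 1 / (q : ℝ) := (one_le_div hq).2 hq1
    rw [add_div]
    linarith
  rw [expectedWrongRandomGraph_eq]
  have key := (isGrowthLaw_wrongLaw (n := n) hq.le hq1 hp0.le hp1.le b).sum_card_le (m := m)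
    hβ0 hβα hα1 (C := x⁻¹) (κ := κ) ?_ (wrongProb_le_one hq.le hq1 hp0.le hp1.le)
    (by positivity) hκ0 ?_
  · refine key.trans ?_
    have h1 : Real.exp (-η) ^ m ≤ Real.exp (-(η * δ / q)) := by
      rw [← Real.exp_nat_mul, Real.exp_le_exp, mul_div_assoc]
      linarith [mul_le_mul_of_nonneg_left hm1 hη0.le]
    have h2 : n * (Real.exp (-η) ^ m / (1 - Real.exp (-η))) ≤
        1 / (1 - Real.exp (-η)) * (n * Real.exp (-(η * δ / q))) := by
      rw [div_mul_eq_mul_div, one_mul, ← mul_div_assoc]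
      exact div_le_div_of_nonneg_right (mul_le_mul_of_nonneg_left h1 (by positivity))
        (sub_pos.2 hη1).le
    have h3 : x⁻¹ * (1 / (1 - Real.exp (-κ))) ≤ x⁻¹ * (2 / ((1 - x) ^ 2 / 2)) / q := by
      refine (mul_le_mul_of_nonneg_left (one_div_one_sub_exp_neg_le hκ0 hκ1)
        (by positivity)).trans_eq ?_
      rw [hκ, ← div_div, mul_div_assoc]
    rw [add_div]
    linarith
  · rintro w r (h | h)
    · refine (wrongProb_le_add hq.le hq1 hp0.le hp1.le w r).trans ?_
      have h1 : ((w + r : ℕ) : ℝ) ≤ δ / q :=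
        (Nat.le_floor_iff (by positivity)).1 (Nat.lt_succ_iff.1 h)
      rw [le_div_iff₀ hq] at h1
      linarith
    · refine (wrongProb_le_one_sub hq.le hq1 hp0.le hρ0.le hρ1.le hρ2.le (hαρ w r h)).trans ?_
      linarith
  · intro w r h
    refine wrongProb_le_exp hq.le hq1 hp0.le hp1.le hx0 hx1.le ?_
    rw [hx2]
    exact hαρ w r h

/-- The first `1 / q` nodes have too few neighbours to correct a wrong signal. -/
lemma le_expectedWrongRandomGraph (n : ℕ) (q p : unitInterval) (b : Bool) (hq : 0 < (q : ℝ))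
    (hn : 1 ≤ (q : ℝ) * n) : (1 - p) / (2 * q) ≤ expectedWrongRandomGraph n q p b := by
  rw [expectedWrongRandomGraph_eq]
  refine le_trans ?_ ((isGrowthLaw_wrongLaw hq.le q.2.2 p.2.1 p.2.2 b).le_sum_card
    (l := fun k => (1 - p) * (1 - q) ^ k) (le_wrongProb hq.le q.2.2 p.2.1 p.2.2))
  have hq1 : (0 : ℝ) ≤ 1 - q := sub_nonneg.2 q.2.2
  have hp1 : (0 : ℝ) ≤ 1 - p := sub_nonneg.2 p.2.2
  have hgeom : (∑ k ∈ Finset.range n, (1 - (q : ℝ)) ^ k) * q = 1 - (1 - q) ^ n := by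
    have := geom_sum_mul (1 - (q : ℝ)) n
    linarith
  -- Thus the geometric sum already has at least half of its limit `1 / q`.
  have hexp : (1 - (q : ℝ)) ^ n ≤ 1 / 2 := by
    calc (1 - (q : ℝ)) ^ n ≤ Real.exp (-q) ^ n :=
          pow_le_pow_left₀ hq1 (by linarith [Real.add_one_le_exp (-(q : ℝ))]) n
      _ = Real.exp (-(q * n)) := by rw [← Real.exp_nat_mul]; ring_nf
      _ ≤ Real.exp (-1) := Real.exp_le_exp.2 (by linarith)
      _ ≤ 1 / 2 := by
          rw [Real.exp_neg, ← one_div]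
          exact one_div_le_one_div_of_le (by norm_num) (by linarith [Real.add_one_le_exp 1])
  rw [← Finset.mul_sum, div_eq_mul_one_div]
  refine mul_le_mul_of_nonneg_left ?_ hp1
  rw [div_le_iff₀ (by positivity)]
  linarith

end InfoCascade

end

/-! ### The choice of `q` -/

theorem theorem1 (p : unitInterval) (hp : (1 / 2 : ℝ) < p) (hp1 : (p : ℝ) < 1) :
    ∃ q : ℕ → unitInterval,
      ((fun n : ℕ => (q n : ℝ)) =Θ[atTop] fun n : ℕ => 1 / Real.log n) ∧
      ∀ b : Bool,
        ((fun n : ℕ => InfoCascade.expectedWrongRandomGraph n (q n) p b)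
          =Θ[atTop] fun n : ℕ => Real.log n) ∧
        Tendsto (fun n : ℕ => InfoCascade.expectedWrongRandomGraph n (q n) p b / n)
          atTop (𝓝 0) := by
  obtain ⟨A, B, c, hA, hB, hc, hle⟩ := InfoCascade.exists_expectedWrongRandomGraph_le p hp hp1
  have hlog : Tendsto (fun n : ℕ => Real.log n) atTop atTop :=
    Real.tendsto_log_atTop.comp tendsto_natCast_atTop_atTop
  have hlogn : (fun n : ℕ => Real.log n) =o[atTop] fun n : ℕ => (n : ℝ) :=
    Real.isLittleO_log_id_atTop.comp_tendsto tendsto_natCast_atTop_atTop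
  -- This makes `n * exp (-(c / q)) = 1` for large `n`. The projection only matters for small `n`,
  -- and `c` was obtained before `b` was fixed.
  set q : ℕ → unitInterval := fun n => Set.projIcc 0 1 zero_le_one (c / Real.log n) with hq
  have hqn : ∀ᶠ n : ℕ in atTop, (q n : ℝ) = c / Real.log n := by
    filter_upwards [hlog.eventually_ge_atTop (max c 1)] with n hn
    have h0 : 0 < Real.log n := lt_of_lt_of_le (by positivity) hn
    have h1 : c / Real.log n ∈ Set.Icc (0 : ℝ) 1 :=
      ⟨by positivity, (div_le_one h0).2 ((le_max_left _ _).trans hn)⟩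
    simp only [hq, Set.projIcc_of_mem zero_le_one h1]
  refine ⟨q, ?_, fun b => ?_⟩
  · have : (fun n : ℕ => (q n : ℝ)) =ᶠ[atTop] fun n => c * (1 / Real.log n) := by
      filter_upwards [hqn] with n hn
      rw [hn, mul_one_div]
    exact this.trans_isTheta ((isTheta_const_mul_left hc.ne').2 (isTheta_refl _ _))
  have hO : (fun n : ℕ => InfoCascade.expectedWrongRandomGraph n (q n) p b) =Θ[atTop]
      fun n : ℕ => Real.log n := by
    have hlower : ∀ᶠ n : ℕ in atTop,
        (1 - p) / (2 * c) * Real.log n ≤ InfoCascade.expectedWrongRandomGraph n (q n) p b := by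
      -- The bound `log n ≤ c * n` is the condition `1 ≤ q * n` of the lower bound.
      filter_upwards [hqn, hlog.eventually_gt_atTop 0, hlogn.bound hc] with n hn h0 hb
      rw [Real.norm_of_nonneg h0.le, Real.norm_of_nonneg (Nat.cast_nonneg n)] at hb
      have := InfoCascade.le_expectedWrongRandomGraph n (q n) p b (by rw [hn]; positivity)
        (by rwa [hn, div_mul_eq_mul_div, one_le_div h0])
      rw [hn] at this
      convert this using 1
      field_simp
    have hp1' : 0 < (1 - p) / (2 * c) := div_pos (by linarith) (by positivity)
    constructor
    · refine IsBigO.of_bound (A / c + B) ?_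
      filter_upwards [hqn, hlog.eventually_ge_atTop 1, hlower, eventually_gt_atTop 0]
        with n hn h0 hl hn0
      have hpos : 0 < Real.log n := by linarith
      rw [Real.norm_of_nonneg (le_trans (by positivity) hl), Real.norm_of_nonneg hpos.le]
      have := hle n (q n) b (by rw [hn]; positivity)
      rw [hn, div_div_cancel₀ hc.ne', Real.exp_neg, Real.exp_log (by exact_mod_cast hn0),
        mul_inv_cancel₀ (by positivity), div_div_eq_mul_div] at this
      calc _ ≤ _ := this
        _ ≤ A * Real.log n / c + B * Real.log n := by
          have := mul_le_mul_of_nonneg_left h0 hB.le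
          linarith
        _ = _ := by ring
    · refine IsBigO.of_bound ((1 - p) / (2 * c))⁻¹ ?_
      filter_upwards [hlog.eventually_ge_atTop 1, hlower] with n h0 hl
      have hpos : 0 < Real.log n := by linarith
      rw [Real.norm_of_nonneg (le_trans (by positivity) hl), Real.norm_of_nonneg hpos.le,
        inv_mul_eq_div, le_div_iff₀ hp1', mul_comm]
      exact hl
  exact ⟨hO, (hO.1.trans_isLittleO hlogn).tendsto_div_nhds_zero⟩
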